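/- Conventions. An $m\times r$ real matrix $\beta$ of full column rank $r$ is an unordered GLT structure if the pivot rows $l_1,\dots,l_r$ of its columns ($l_j$ is the row of the first nonzero entry of column $j$) are pairwise distinct. Its sparsity matrix is $\delta=(1\{\beta_{ij}\neq 0\})_{ij}$. A signed permutation of $\beta$ is a matrix $\beta P_{\pm}P_{\rho}$ with $P_{\pm}=\mathrm{Diag}(\pm1,\dots,\pm1)$ and $P_\rho$ a permutation matrix. $\Theta_\delta$ is the set of all unordered GLT structures with sparsity matrix $\delta$ together with all their signed permutations; "measure 0" refers to Lebesgue measure in the nonzero loadings, for each order of the columns. A binary $m\times r$ matrix $\delta$ satisfies the 3579 counting rule $CR(r,1)$ if for each $q=1,\dots,r$ every submatrix built from $q$ columns of $\delta$ has at least $2q+1$ nonzero rows. A matrix $\beta\in\mathbb R^{m\times r}$ has the row deletion property AR if, whenever one row is deleted, two disjoint sets of the remaining rows each form a submatrix of rank $r$. For $\beta\in\Theta_\delta$ and a positive definite diagonal $\Sigma$, variance identification holds at $(\beta,\Sigma)$ if for every decomposition $\beta\beta^\top+\Sigma=\tilde\beta\tilde\beta^\top+\tilde\Sigma$ with an $m\times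 r$ unordered GLT matrix $\tilde\beta$ and a positive definite diagonal $\tilde\Sigma$ one has $\tilde\Sigma=\Sigma$, i.e. $\tilde\beta\tilde\beta^\top=\beta\beta^\top$. Statement. Let $\delta$ be the sparsity matrix of an $m\times r$ unordered GLT structure. (a) If $\delta$ satisfies $CR(r,1)$, then for all $\beta\in\Theta_\delta$ except for a set of measure 0 and for every positive definite diagonal $\Sigma$, variance identification holds at $(\beta,\Sigma)$: for any other decomposition $\beta\beta^\top+\Sigma=\tilde\beta\tilde\beta^\top+\tilde\Sigma$ with $\tilde\beta$ an $m\times r$ unordered GLT matrix and $\tilde\Sigma$ positive definite diagonal, $\tilde\Sigma=\Sigma$, $\tilde\beta\tilde\beta^\top=\beta\beta^\top$, and $\tilde\beta=\beta P_\pm P_\rho$ is a signed permutation of $\beta$. (b) If $\delta$ violates $CR(r,1)$, then AR fails for every $\beta\in\Theta_\delta$. (c) Let $r=1$, or $r=2$, or $r=3$, where for $r=3$ it is assumed that $\delta$ has at least $7$ nonzero rows. Then $CR(r,1)$ is necessary and sufficient for variance identification: $\delta$ satisfies $CR(r,1)$ if and only if, for all $\beta\in\Theta_\delta$ except for a set of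 measure 0, variance identification holds at $(\beta,\Sigma)$ for every positive definite diagonal $\Sigma$; moreover, if $\delta$ violates $CR(r,1)$, then variance identification fails at $(\beta,\Sigma)$ for every $\beta\in\Theta_\delta$ and every positive definite diagonal $\Sigma$. -/

import Mathlib

open Matrix MeasureTheory

noncomputable section

/-- `l` is the pivot row of column `j` of `β`: the row of its first nonzero entry. -/
def IsPivotRow {m r : ℕ} (β : Matrix (Fin m) (Fin r) ℝ) (j : Fin r) (l : Fin m) : Prop :=
  (∀ i, i < l → β i j = 0) ∧ β l j ≠ 0

/-- Unordered GLT structure: full column rank, and the columns (all nonzero) have pairwise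
distinct pivot rows. -/
def IsUnorderedGLT {m r : ℕ} (β : Matrix (Fin m) (Fin r) ℝ) : Prop :=
  β.rank = r ∧ ∃ l : Fin r → Fin m, Function.Injective l ∧ ∀ j, IsPivotRow β j (l j)

open Classical in
/-- The sparsity matrix of `β`: the 0/1 indicator of its nonzero entries. -/
def sparsityMatrix {m r : ℕ} (β : Matrix (Fin m) (Fin r) ℝ) : Matrix (Fin m) (Fin r) Bool :=
  fun i j => decide (β i j ≠ 0)

/-- The binary matrix `δ` is the sparsity matrix of some unordered GLT structure. -/
def IsUnorderedGLTSparsity {m r : ℕ} (δ : Matrix (Fin m) (Fin r) Bool) : Prop :=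
  ∃ β : Matrix (Fin m) (Fin r) ℝ, IsUnorderedGLT β ∧ sparsityMatrix β = δ

/-- `B` is a signed permutation of `β`: `B = β P_± P_ρ` with `P_±` a diagonal matrix of signs and
`P_ρ` a permutation matrix. -/
def IsSignedPermutation {m r : ℕ} (B β : Matrix (Fin m) (Fin r) ℝ) : Prop :=
  ∃ (ε : Fin r → ℝ) (ρ : Equiv.Perm (Fin r)), (∀ j, ε j = 1 ∨ ε j = -1) ∧
    B = β * Matrix.diagonal ε * ρ.permMatrix ℝ

/-- `Θ_δ`: all unordered GLT structures with sparsity matrix `δ` and all their signed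
permutations. -/
def Theta {m r : ℕ} (δ : Matrix (Fin m) (Fin r) Bool) : Set (Matrix (Fin m) (Fin r) ℝ) :=
  {B | ∃ β : Matrix (Fin m) (Fin r) ℝ,
    IsUnorderedGLT β ∧ sparsityMatrix β = δ ∧ IsSignedPermutation B β}

/-- The matrix whose entries at the positions marked by `δ` are the free parameters `x`, and whose
other entries are zero. -/
def fillIn {m r : ℕ} (δ : Matrix (Fin m) (Fin r) Bool)
    (x : {p : Fin m × Fin r // δ p.1 p.2 = true} → ℝ) : Matrix (Fin m) (Fin r) ℝ :=
  fun i j => if h : δ i j = true then x ⟨(i, j), h⟩ else 0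

/-- `N` has measure 0 in `Θ_δ`. The set `Θ_δ` is a finite union, over the permutations `ρ` of the
columns, of sets parametrized by the vector of the loadings that are not structurally zero; `N` has
measure 0 if, in each of these pieces, the parameters of the matrices in `N` form a Lebesgue null
set. -/
def IsNullInTheta {m r : ℕ} (δ : Matrix (Fin m) (Fin r) Bool)
    (N : Set (Matrix (Fin m) (Fin r) ℝ)) : Prop :=
  ∀ ρ : Equiv.Perm (Fin r),
    volume {x : {p : Fin m × Fin r // δ p.1 p.2 = true} → ℝ |
      (fillIn δ x).submatrix id ρ ∈ N} = 0

open Classical in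
/-- The number of nonzero rows of the submatrix of `δ` built from the columns in `J`. -/
def nonzeroRows {m r : ℕ} (δ : Matrix (Fin m) (Fin r) Bool) (J : Finset (Fin r)) : ℕ :=
  (Finset.univ.filter (fun i : Fin m => ∃ j ∈ J, δ i j = true)).card

/-- Counting rule `CR(r, s)`: every submatrix of `q = 1, …, r` columns has at least `2 q + s`
nonzero rows. The 3579 counting rule is the case `s = 1`. -/
def CountingRule {m r : ℕ} (δ : Matrix (Fin m) (Fin r) Bool) (s : ℕ) : Prop :=
  ∀ J : Finset (Fin r), J.Nonempty → 2 * J.card + s ≤ nonzeroRows δ J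

/-- Row deletion property `AR`: whenever a row is deleted, two disjoint submatrices (sets of rows)
of rank `r` remain. -/
def RowDeletionProperty {m r : ℕ} (β : Matrix (Fin m) (Fin r) ℝ) : Prop :=
  ∀ i : Fin m, ∃ S T : Finset (Fin m), i ∉ S ∧ i ∉ T ∧ Disjoint S T ∧
    (β.submatrix (fun k : S => (k : Fin m)) id).rank = r ∧
    (β.submatrix (fun k : T => (k : Fin m)) id).rank = r

/-- `(B, τ)` is a factor decomposition, with an unordered GLT loading matrix `B` and positive
idiosyncratic variances `τ`, of the covariance matrix `Ω`. -/
def IsGLTDecomposition {m r : ℕ} (Ω : Matrix (Fin m) (Fin m) ℝ)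
    (B : Matrix (Fin m) (Fin r) ℝ) (τ : Fin m → ℝ) : Prop :=
  IsUnorderedGLT B ∧ (∀ i, 0 < τ i) ∧ Ω = B * Bᵀ + Matrix.diagonal τ

/-- Variance identification at `(β, σ)`: every decomposition of `Ω = β βᵀ + diag σ` with an
unordered GLT loading matrix of the same size has the same idiosyncratic variances and the same
cross-covariance matrix. -/
def VarianceIdentified {m r : ℕ} (β : Matrix (Fin m) (Fin r) ℝ) (σ : Fin m → ℝ) : Prop :=
  ∀ (B : Matrix (Fin m) (Fin r) ℝ) (τ : Fin m → ℝ),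
    IsGLTDecomposition (β * βᵀ + Matrix.diagonal σ) B τ → τ = σ ∧ B * Bᵀ = β * βᵀ

end

/-! The row deletion property AR links the counting rule to identification. By Anderson and Rubin,
AR implies variance identification: two disjoint rank-r row sets avoiding row i express the
communality of row i through off-diagonal covariances, which no diagonal matrix affects. Once the
cross-products agree, two GLT matrices differ by an orthogonal Q, and distinct pivots force Q to be
a signed permutation (`isSignedPermutation_of_mul_transpose_eq`).

The counting rule is the combinatorial form of AR. It is necessary: a rank-r row set meets the
support of q columns in at least q rows, so two disjoint ones plus the deleted row give 2q + 1. It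
is generically sufficient: Hall's theorem matches every column twice outside the deleted row, and
each matched minor vanishes only on a null set of loadings.

In (c), a violation must occur in one column with at most two nonzero rows or in two columns with at
most four; the seven-row assumption excludes three columns. Such columns can be deformed so that
only the diagonal of ββᵀ changes. The variances absorb the change, and Gram–Schmidt turns the
deformed factor into a GLT matrix (`exists_isUnorderedGLT_mul_transpose_eq`). -/

/-! ### Full column rank, pivots and signed permutations -/

theorem rank_eq_iff_exists_left_inverse {ι : Type*} [Fintype ι] {r : ℕ}
    (A : Matrix ι (Fin r) ℝ) : A.rank = r ↔ ∃ L : Matrix (Fin r) ι ℝ, L * A = 1 := by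
  classical
  constructor
  · intro h
    have h1 : (Aᵀ * A).rank = r := by rw [rank_transpose_mul_self, h]
    have h2 : IsUnit (Aᵀ * A) := by
      rw [← mulVec_surjective_iff_isUnit]
      have : LinearMap.range (Aᵀ * A).mulVecLin = ⊤ :=
        Submodule.eq_top_of_finrank_eq (by simpa [Matrix.rank] using h1)
      exact LinearMap.range_eq_top.mp this
    refine ⟨(Aᵀ * A)⁻¹ * Aᵀ, ?_⟩
    rw [Matrix.mul_assoc]
    exact Matrix.nonsing_inv_mul _ ((Matrix.isUnit_iff_isUnit_det _).mp h2)
  · rintro ⟨L, hL⟩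
    refine le_antisymm ((rank_le_card_width A).trans_eq (Fintype.card_fin r)) ?_
    calc r = (1 : Matrix (Fin r) (Fin r) ℝ).rank := by simp
      _ = (L * A).rank := by rw [hL]
      _ ≤ A.rank := rank_mul_le_right _ _

theorem rank_eq_of_forall_mulVec_eq_zero {ι : Type*} [Fintype ι] {r : ℕ}
    {A : Matrix ι (Fin r) ℝ} (h : ∀ v, A *ᵥ v = 0 → v = 0) : A.rank = r := by
  have : LinearIndependent ℝ A.col := by
    rw [← Matrix.mulVec_injective_iff]
    intro v w hvw
    have := h (v - w) (by rw [Matrix.mulVec_sub]; exact sub_eq_zero.mpr hvw)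
    exact sub_eq_zero.mp this
  rw [← rank_transpose, LinearIndependent.rank_matrix (M := Aᵀ) this, Fintype.card_fin]

theorem eq_zero_of_mulVec_eq_zero {ι : Type*} [Fintype ι] {r : ℕ}
    {A : Matrix ι (Fin r) ℝ} (hA : A.rank = r) {v : Fin r → ℝ} (hv : A *ᵥ v = 0) : v = 0 := by
  obtain ⟨L, hL⟩ := (rank_eq_iff_exists_left_inverse A).mp hA
  calc v = (L * A) *ᵥ v := by rw [hL, one_mulVec]
    _ = 0 := by rw [← mulVec_mulVec, hv, mulVec_zero]

/-- A matrix whose columns have distinct pivot rows has full column rank. -/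
theorem rank_eq_of_pivotRows {m r : ℕ} {β : Matrix (Fin m) (Fin r) ℝ} {l : Fin r → Fin m}
    (hl : Function.Injective l) (hp : ∀ j, IsPivotRow β j (l j)) : β.rank = r := by
  apply rank_eq_of_forall_mulVec_eq_zero
  intro v hv
  by_contra hne
  obtain ⟨j₀, hj₀⟩ := Function.ne_iff.mp hne
  -- Among the columns in the support of `v`, take the one with the topmost pivot: in that row the
  -- other columns of the support still vanish.
  obtain ⟨j, hj, hmin⟩ := Finset.exists_min_image
    (Finset.univ.filter fun j => v j ≠ 0) l ⟨j₀, by simpa using hj₀⟩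
  have hjv : v j ≠ 0 := by simpa using hj
  have h := congrFun hv (l j)
  simp only [mulVec, dotProduct, Pi.zero_apply] at h
  rw [Finset.sum_eq_single j] at h
  · exact mul_ne_zero (hp j).2 hjv h
  · intro k _ hkj
    by_cases hk : v k = 0
    · simp [hk]
    · have hle : l j ≤ l k := hmin k (by simpa using hk)
      have hlt : l j < l k := lt_of_le_of_ne hle fun e => hkj (hl e).symm
      rw [(hp k).1 _ hlt, zero_mul]
  · simp

theorem mul_permMatrix_apply {m r : ℕ} (A : Matrix (Fin m) (Fin r) ℝ)
    (ρ : Equiv.Perm (Fin r)) (i : Fin m) (j : Fin r) :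
    (A * ρ.permMatrix ℝ) i j = A i (ρ.symm j) := by
  rw [Equiv.Perm.permMatrix, PEquiv.mul_toMatrix_toPEquiv]; rfl

theorem isSignedPermutation_apply {m r : ℕ} (A : Matrix (Fin m) (Fin r) ℝ) (ε : Fin r → ℝ)
    (ρ : Equiv.Perm (Fin r)) (i : Fin m) (j : Fin r) :
    (A * diagonal ε * ρ.permMatrix ℝ) i j = A i (ρ.symm j) * ε (ρ.symm j) := by
  rw [mul_permMatrix_apply, mul_diagonal]

/-! ### Anderson–Rubin: AR implies variance identification -/

/-- The Anderson–Rubin argument for one row: two disjoint sets of other rows with full column rank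
determine the communality of the row from the off-diagonal entries of the covariance matrix. -/
theorem communality_eq_of_offDiag_eq {m r : ℕ} {β B : Matrix (Fin m) (Fin r) ℝ}
    (h : ∀ i k, i ≠ k → (B * Bᵀ) i k = (β * βᵀ) i k) {i : Fin m} {S T : Finset (Fin m)}
    (hiS : i ∉ S) (hiT : i ∉ T) (hST : Disjoint S T)
    (hS : (β.submatrix (fun k : S => (k : Fin m)) id).rank = r)
    (hT : (β.submatrix (fun k : T => (k : Fin m)) id).rank = r) :
    (B * Bᵀ) i i = (β * βᵀ) i i := by
  obtain ⟨L, hL⟩ := (rank_eq_iff_exists_left_inverse _).mp hS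
  obtain ⟨K, hK⟩ := (rank_eq_iff_exists_left_inverse _).mp hT
  set bS := β.submatrix (fun k : S => (k : Fin m)) id
  set bT := β.submatrix (fun k : T => (k : Fin m)) id
  set bi := β.submatrix (fun _ : Unit => i) id
  set BS := B.submatrix (fun k : S => (k : Fin m)) id
  set BT := B.submatrix (fun k : T => (k : Fin m)) id
  set Bi := B.submatrix (fun _ : Unit => i) id
  have hSTeq : BS * BTᵀ = bS * bTᵀ := by
    ext a b
    exact h a b fun e => Finset.disjoint_left.mp hST a.2 (e ▸ b.2)
  have hiTeq : Bi * BTᵀ = bi * bTᵀ := by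
    ext a b
    exact h i b fun e => hiT (e ▸ b.2)
  have hSieq : BS * Biᵀ = bS * biᵀ := by
    ext a b
    exact h a i fun e => hiS (e ▸ a.2)
  -- Both factors are r × r, hence mutually inverse. So `BTᵀ` can be cancelled below, which shows
  -- that row i of `B` depends on the rows in S with the same coefficients as row i of `β`.
  have h1 : L * BS * (BTᵀ * Kᵀ) = 1 := by
    calc L * BS * (BTᵀ * Kᵀ) = L * (BS * BTᵀ) * Kᵀ := by simp only [Matrix.mul_assoc]
      _ = (L * bS) * (K * bT)ᵀ := by rw [hSTeq, transpose_mul]; simp only [Matrix.mul_assoc]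
      _ = 1 := by rw [hL, hK]; simp
  have h2 : BTᵀ * Kᵀ * (L * BS) = 1 := mul_eq_one_comm.mp h1
  have h3 : (Bi - bi * L * BS) * BTᵀ = 0 := by
    rw [Matrix.sub_mul, Matrix.mul_assoc (bi * L), hSTeq, hiTeq, Matrix.mul_assoc bi,
      ← Matrix.mul_assoc L, hL, Matrix.one_mul, sub_self]
  have h4 : Bi = bi * L * BS := by
    rw [← sub_eq_zero]
    calc Bi - bi * L * BS = (Bi - bi * L * BS) * (BTᵀ * Kᵀ * (L * BS)) := by
          rw [h2, Matrix.mul_one]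
      _ = 0 := by simp only [← Matrix.mul_assoc] at h3 ⊢; rw [h3]; simp
  have h5 : Bi * Biᵀ = bi * biᵀ := by
    calc Bi * Biᵀ = bi * L * BS * Biᵀ := by rw [← h4]
      _ = bi * (L * bS) * biᵀ := by
        rw [Matrix.mul_assoc (bi * L), hSieq]; simp only [Matrix.mul_assoc]
      _ = bi * biᵀ := by rw [hL, Matrix.mul_one]
  exact congrFun (congrFun h5 ()) ()

/-- The Anderson–Rubin theorem: the row deletion property implies variance identification. -/
theorem RowDeletionProperty.varianceIdentified {m r : ℕ} {β : Matrix (Fin m) (Fin r) ℝ}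
    (hβ : RowDeletionProperty β) (σ : Fin m → ℝ) : VarianceIdentified β σ := by
  rintro B τ ⟨-, -, hΩ⟩
  have hoff : ∀ i k, i ≠ k → (B * Bᵀ) i k = (β * βᵀ) i k := by
    intro i k hik
    have := congrFun (congrFun hΩ i) k
    simpa [diagonal_apply_ne _ hik] using this.symm
  have hBB : B * Bᵀ = β * βᵀ := by
    ext i k
    by_cases hik : i = k
    · subst hik
      obtain ⟨S, T, hiS, hiT, hST, hS, hT⟩ := hβ i
      exact communality_eq_of_offDiag_eq hoff hiS hiT hST hS hT
    · exact hoff i k hik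
  refine ⟨?_, hBB⟩
  rw [hBB] at hΩ
  exact (diagonal_injective (add_left_cancel hΩ)).symm

/-! ### Rotational uniqueness of GLT structures -/

/-- If `B = β Q` with both matrices unordered GLT, then the pivot row of a column of `B` is the
smallest pivot row of the columns of `β` that contribute to it. -/
theorem exists_min_pivotRow {m r : ℕ} {β B : Matrix (Fin m) (Fin r) ℝ}
    {Q : Matrix (Fin r) (Fin r) ℝ} (hQ : B = β * Q) {l k : Fin r → Fin m}
    (hl : Function.Injective l) (hβ : ∀ j, IsPivotRow β j (l j))
    (hB : ∀ j, IsPivotRow B j (k j)) (j : Fin r) :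
    ∃ a, k j = l a ∧ Q a j ≠ 0 ∧ ∀ b, Q b j ≠ 0 → l a ≤ l b := by
  have hne : ∃ a, Q a j ≠ 0 := by
    by_contra! h0
    refine (hB j).2 ?_
    rw [hQ, mul_apply]
    exact Finset.sum_eq_zero fun a _ => by rw [h0 a, mul_zero]
  obtain ⟨a₀, ha₀⟩ := hne
  obtain ⟨a, ha, hmin⟩ := Finset.exists_min_image
    (Finset.univ.filter fun a => Q a j ≠ 0) l ⟨a₀, by simpa using ha₀⟩
  have haQ : Q a j ≠ 0 := by simpa using ha
  have hmin' : ∀ b, Q b j ≠ 0 → l a ≤ l b := fun b hb => hmin b (by simpa using hb)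
  refine ⟨a, ?_, haQ, hmin'⟩
  have hzero : ∀ i, i < l a → B i j = 0 := by
    intro i hi
    rw [hQ, mul_apply]
    refine Finset.sum_eq_zero fun b _ => ?_
    by_cases hb : Q b j = 0
    · rw [hb, mul_zero]
    · rw [(hβ b).1 i (hi.trans_le (hmin' b hb)), zero_mul]
  have hnz : B (l a) j ≠ 0 := by
    rw [hQ, mul_apply, Finset.sum_eq_single a]
    · exact mul_ne_zero (hβ a).2 haQ
    · intro b _ hba
      by_cases hb : Q b j = 0
      · rw [hb, mul_zero]
      · rw [(hβ b).1 _ (lt_of_le_of_ne (hmin' b hb) fun e => hba (hl e).symm), zero_mul]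
    · simp
  exact le_antisymm (not_lt.mp fun h => hnz ((hB j).1 _ h)) (not_lt.mp fun h => (hB j).2 (hzero _ h))

/-- Two unordered GLT matrices with the same cross-product matrix are signed permutations of each
other. -/
theorem isSignedPermutation_of_mul_transpose_eq {m r : ℕ} {β B : Matrix (Fin m) (Fin r) ℝ}
    (hβ : IsUnorderedGLT β) (hB : IsUnorderedGLT B) (h : B * Bᵀ = β * βᵀ) :
    IsSignedPermutation B β := by
  obtain ⟨hβr, l, hl, hβl⟩ := hβ
  obtain ⟨hBr, k, hk, hBk⟩ := hB
  obtain ⟨L, hL⟩ := (rank_eq_iff_exists_left_inverse _).mp hβr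
  obtain ⟨K, hK⟩ := (rank_eq_iff_exists_left_inverse _).mp hBr
  have hK' : Bᵀ * Kᵀ = 1 := by rw [← transpose_mul, hK, transpose_one]
  have hL' : βᵀ * Lᵀ = 1 := by rw [← transpose_mul, hL, transpose_one]
  obtain ⟨Q, hBQ⟩ : ∃ Q, B = β * Q := ⟨βᵀ * Kᵀ, by
    rw [← Matrix.mul_assoc, ← h, Matrix.mul_assoc, hK', Matrix.mul_one]⟩
  have hQ1 : Q * Qᵀ = 1 := by
    have e : β * (Q * Qᵀ) * βᵀ = β * βᵀ := by
      calc β * (Q * Qᵀ) * βᵀ = (β * Q) * (β * Q)ᵀ := by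
            rw [transpose_mul]; simp only [Matrix.mul_assoc]
        _ = β * βᵀ := by rw [← hBQ, h]
    calc Q * Qᵀ = (L * β) * (Q * Qᵀ) * (βᵀ * Lᵀ) := by rw [hL, hL']; simp
      _ = L * (β * (Q * Qᵀ) * βᵀ) * Lᵀ := by simp only [Matrix.mul_assoc]
      _ = (L * β) * (βᵀ * Lᵀ) := by rw [e]; simp only [Matrix.mul_assoc]
      _ = 1 := by rw [hL, hL']; simp
  have hQ2 : Qᵀ * Q = 1 := mul_eq_one_comm.mp hQ1
  have hβQ : β = B * Qᵀ := by rw [hBQ, Matrix.mul_assoc, hQ1, Matrix.mul_one]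
  choose ρ hρ hρne hρmin using exists_min_pivotRow hBQ hl hβl hBk
  choose π hπ hπne hπmin using exists_min_pivotRow hβQ hk hBk hβl
  have hρπ : ∀ j, ρ (π j) = j := fun j => hl (by rw [← hρ, hπ])
  have hπρ : ∀ j, π (ρ j) = j := fun j => hk (by rw [← hπ, hρ])
  -- Minimality of pivots for `B = β Q` gives `l (ρ b) ≤ l a`; minimality for the inverse relation
  -- `β = B Qᵀ` gives the reverse inequality.
  have hQ0 : ∀ a b, Q a b ≠ 0 → a = ρ b := by
    intro a b hab
    have h1 := hρmin b a hab
    have h2 := hπmin a b hab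
    rw [hρ b, hρ (π a), hρπ] at h2
    exact hl (le_antisymm h2 h1)
  let e : Equiv.Perm (Fin r) := ⟨π, ρ, hρπ, hπρ⟩
  refine ⟨fun a => Q a (π a), e, fun a => ?_, ?_⟩
  · have h1 := congrFun (congrFun hQ1 a) a
    rw [mul_apply, one_apply_eq, Finset.sum_eq_single (π a)] at h1
    · exact mul_self_eq_one_iff.mp h1
    · intro b _ hb
      by_cases hab : Q a b = 0
      · rw [hab, zero_mul]
      · exact absurd (by rw [hQ0 a b hab, hπρ]) hb
    · simp
  · ext i j
    rw [isSignedPermutation_apply, hBQ, mul_apply, Finset.sum_eq_single (ρ j)]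
    · change _ = β i (ρ j) * Q (ρ j) (π (ρ j))
      rw [hπρ]
    · intro a _ ha
      by_cases haj : Q a j = 0
      · rw [haj, mul_zero]
      · exact absurd (hQ0 a j haj) ha
    · simp

/-! ### Invariance of row counts within `Theta` -/

/-- Signs never vanish, so a signed permutation carries pivots and supports along with the columns.
Counts for members of `Theta δ` thus reduce to counts for `δ`. -/
theorem exists_perm_nonzeroRows_sparsityMatrix {m r : ℕ} {δ : Matrix (Fin m) (Fin r) Bool}
    {β : Matrix (Fin m) (Fin r) ℝ} (hβ : β ∈ Theta δ) :
    IsUnorderedGLT β ∧ ∃ ρ : Equiv.Perm (Fin r),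
      ∀ J, nonzeroRows (sparsityMatrix β) J = nonzeroRows δ (J.map ρ.toEmbedding) := by
  obtain ⟨A, ⟨-, l, hl, hp⟩, rfl, ε, ρ, hε, rfl⟩ := hβ
  have hε0 : ∀ j, ε j ≠ 0 := fun j => by rcases hε j with h | h <;> rw [h] <;> norm_num
  have hpiv : ∀ j, IsPivotRow (A * diagonal ε * ρ.permMatrix ℝ) j (l (ρ.symm j)) := by
    intro j
    refine ⟨fun i hi => ?_, ?_⟩
    · rw [isSignedPermutation_apply, (hp _).1 i hi, zero_mul]
    · rw [isSignedPermutation_apply]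
      exact mul_ne_zero (hp _).2 (hε0 _)
  have hinj : Function.Injective fun j => l (ρ.symm j) := hl.comp ρ.symm.injective
  refine ⟨⟨rank_eq_of_pivotRows hinj hpiv, _, hinj, hpiv⟩, ρ.symm, fun J => ?_⟩
  classical
  unfold nonzeroRows
  refine congrArg Finset.card (Finset.filter_congr fun i _ => ?_)
  simp only [sparsityMatrix, isSignedPermutation_apply, decide_eq_true_eq, Finset.mem_map_equiv,
    Equiv.symm_symm, ne_eq, mul_eq_zero, hε0, or_false]
  exact ⟨fun ⟨j, hj, h⟩ => ⟨ρ.symm j, by simpa using hj, h⟩,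
    fun ⟨j, hj, h⟩ => ⟨ρ j, hj, by simpa using h⟩⟩

theorem countingRule_sparsityMatrix {m r s : ℕ} {δ : Matrix (Fin m) (Fin r) Bool}
    {β : Matrix (Fin m) (Fin r) ℝ} (hβ : β ∈ Theta δ) (h : CountingRule (sparsityMatrix β) s) :
    CountingRule δ s := by
  obtain ⟨-, ρ, hρ⟩ := exists_perm_nonzeroRows_sparsityMatrix hβ
  intro J hJ
  have := h (J.map ρ.symm.toEmbedding) (hJ.map)
  rw [hρ, Finset.card_map, Finset.map_map] at this
  simpa using this

theorem nonzeroRows_sparsityMatrix_univ {m r : ℕ} {δ : Matrix (Fin m) (Fin r) Bool}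
    {β : Matrix (Fin m) (Fin r) ℝ} (hβ : β ∈ Theta δ) :
    nonzeroRows (sparsityMatrix β) Finset.univ = nonzeroRows δ Finset.univ := by
  obtain ⟨-, ρ, hρ⟩ := exists_perm_nonzeroRows_sparsityMatrix hβ
  rw [hρ, Finset.map_univ_equiv]

/-! ### AR implies the counting rule -/

open Classical in
theorem nonzeroRows_sparsityMatrix {m r : ℕ} (β : Matrix (Fin m) (Fin r) ℝ)
    (J : Finset (Fin r)) : nonzeroRows (sparsityMatrix β) J =
      (Finset.univ.filter fun i => ∃ j ∈ J, β i j ≠ 0).card := by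
  unfold nonzeroRows
  congr 1
  ext i
  simp [sparsityMatrix]

open Classical in
/-- A row set of full column rank meets the support of any set of columns in at least as many
rows. -/
theorem card_le_card_support_of_rank_eq {m r : ℕ} {β : Matrix (Fin m) (Fin r) ℝ}
    {S : Finset (Fin m)} (hS : (β.submatrix (fun k : S => (k : Fin m)) id).rank = r)
    (J : Finset (Fin r)) : J.card ≤ (S.filter fun i => ∃ j ∈ J, β i j ≠ 0).card := by
  set S' := S.filter fun i => ∃ j ∈ J, β i j ≠ 0
  let A : Matrix S' J ℝ := β.submatrix (fun k => (k : Fin m)) (fun j => (j : Fin r))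
  have hinj : Function.Injective A.mulVecLin := by
    rw [← LinearMap.ker_eq_bot, LinearMap.ker_eq_bot']
    intro v hv
    -- Extended by zero, a kernel vector on the columns J is killed by all rows of S: those outside
    -- `S'` have no nonzero entry in J.
    let w : Fin r → ℝ := fun j => if h : j ∈ J then v ⟨j, h⟩ else 0
    have hw : ∀ i, (β *ᵥ w) i = ∑ j : J, β i j * v j := by
      intro i
      rw [mulVec, dotProduct, ← Finset.sum_subset (Finset.subset_univ J),
        ← Finset.sum_coe_sort J]
      · exact Finset.sum_congr rfl fun j _ => by simp [w]
      · intro j _ hj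
        simp [w, hj]
    have hw0 : w = 0 := by
      apply eq_zero_of_mulVec_eq_zero hS
      ext k
      change (β *ᵥ w) k = 0
      rw [hw]
      by_cases hk : (k : Fin m) ∈ S'
      · exact congrFun hv ⟨k, hk⟩
      · refine Finset.sum_eq_zero fun j _ => ?_
        have : β k j = 0 := by
          by_contra h0
          exact hk (Finset.mem_filter.mpr ⟨k.2, j, j.2, h0⟩)
        rw [this, zero_mul]
    ext j
    have := congrFun hw0 j
    simpa [w] using this
  simpa using LinearMap.finrank_le_finrank_of_injective hinj

/-- The row deletion property implies the 3579 counting rule for the sparsity pattern. -/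
theorem RowDeletionProperty.countingRule {m r : ℕ} {β : Matrix (Fin m) (Fin r) ℝ}
    (hβ : ∀ j, ∃ i, β i j ≠ 0) (h : RowDeletionProperty β) :
    CountingRule (sparsityMatrix β) 1 := by
  classical
  rintro J ⟨j, hj⟩
  -- The deleted row is taken from the support of J, so it supplies the extra 1 in 2q + 1.
  obtain ⟨i, hi⟩ := hβ j
  obtain ⟨S, T, hiS, hiT, hST, hS, hT⟩ := h i
  have h1 := card_le_card_support_of_rank_eq hS J
  have h2 := card_le_card_support_of_rank_eq hT J
  rw [nonzeroRows_sparsityMatrix]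
  have hdisj : Disjoint (S.filter fun i => ∃ j ∈ J, β i j ≠ 0)
      (T.filter fun i => ∃ j ∈ J, β i j ≠ 0) := Finset.disjoint_filter_filter hST
  have hni : i ∉ (S.filter fun i => ∃ j ∈ J, β i j ≠ 0) ∪
      (T.filter fun i => ∃ j ∈ J, β i j ≠ 0) := by
    simp [hiS, hiT]
  have hsub : insert i ((S.filter fun i => ∃ j ∈ J, β i j ≠ 0) ∪
      (T.filter fun i => ∃ j ∈ J, β i j ≠ 0)) ⊆
      Finset.univ.filter fun i => ∃ j ∈ J, β i j ≠ 0 := by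
    intro k hk
    simp only [Finset.mem_insert, Finset.mem_union, Finset.mem_filter] at hk
    rcases hk with rfl | hk | hk
    · exact Finset.mem_filter.mpr ⟨Finset.mem_univ _, j, hj, hi⟩
    · exact Finset.mem_filter.mpr ⟨Finset.mem_univ _, hk.2⟩
    · exact Finset.mem_filter.mpr ⟨Finset.mem_univ _, hk.2⟩
  have h3 := Finset.card_le_card hsub
  rw [Finset.card_insert_of_notMem hni, Finset.card_union_of_disjoint hdisj] at h3
  omega

theorem IsUnorderedGLT.exists_ne_zero {m r : ℕ} {β : Matrix (Fin m) (Fin r) ℝ}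
    (hβ : IsUnorderedGLT β) (j : Fin r) : ∃ i, β i j ≠ 0 := by
  obtain ⟨-, l, -, hp⟩ := hβ
  exact ⟨l j, (hp j).2⟩

/-! ### The counting rule implies AR generically -/

/-- Under the 3579 counting rule, after deleting any row the columns can be matched twice, with
disjoint sets of rows, to nonzero entries. -/
theorem CountingRule.exists_matchings {m r : ℕ} {δ : Matrix (Fin m) (Fin r) Bool}
    (h : CountingRule δ 1) (i : Fin m) :
    ∃ f : Fin r × Bool → Fin m, Function.Injective f ∧ ∀ x, f x ≠ i ∧ δ (f x) x.1 = true := by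
  classical
  -- Hall's theorem with two copies of each column: 2q rows serve the copies of q columns, and the
  -- surplus row pays for the erased `i`.
  let t : Fin r × Bool → Finset (Fin m) :=
    fun x => (Finset.univ.filter fun k => δ k x.1 = true).erase i
  obtain ⟨f, hf, hft⟩ := (Finset.all_card_le_biUnion_card_iff_exists_injective t).mp (by
    intro s
    rcases s.eq_empty_or_nonempty with rfl | hs
    · simp
    have h1 : s.card ≤ 2 * (s.image Prod.fst).card := by
      have : s ⊆ (s.image Prod.fst) ×ˢ (Finset.univ : Finset Bool) := by
        intro x hx
        exact Finset.mem_product.mpr ⟨Finset.mem_image_of_mem _ hx, Finset.mem_univ _⟩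
      have := Finset.card_le_card this
      rw [Finset.card_product] at this
      simpa [mul_comm] using this
    have h2 := h (s.image Prod.fst) (hs.image _)
    have h3 : (Finset.univ.filter fun k => ∃ j ∈ s.image Prod.fst, δ k j = true).erase i ⊆
        s.biUnion t := by
      intro k hk
      simp only [Finset.mem_erase, Finset.mem_filter, Finset.mem_univ, true_and,
        Finset.mem_image] at hk
      obtain ⟨hki, j, ⟨x, hx, rfl⟩, hkj⟩ := hk
      exact Finset.mem_biUnion.mpr ⟨x, hx, by simp [t, hki, hkj]⟩
    have h4 := Finset.card_le_card h3
    have h5 := Finset.pred_card_le_card_erase (a := i)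
      (s := Finset.univ.filter fun k => ∃ j ∈ s.image Prod.fst, δ k j = true)
    have h6 : nonzeroRows δ (s.image Prod.fst) =
        (Finset.univ.filter fun k => ∃ j ∈ s.image Prod.fst, δ k j = true).card := by
      unfold nonzeroRows; congr
    omega)
  refine ⟨f, hf, fun x => ?_⟩
  simpa [t] using hft x

theorem continuous_fillIn {m r : ℕ} (δ : Matrix (Fin m) (Fin r) Bool) :
    Continuous (fillIn δ) := by
  refine continuous_pi fun i => continuous_pi fun j => ?_
  unfold fillIn
  split_ifs <;> fun_prop

/-- The minor selected by a matching of the columns to nonzero entries is generically nonzero. -/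
theorem ae_det_fillIn_submatrix_ne_zero {m r : ℕ} {δ : Matrix (Fin m) (Fin r) Bool}
    {f : Fin r → Fin m} (hf : Function.Injective f) (hδ : ∀ j, δ (f j) j = true) :
    ∀ᵐ x : {p : Fin m × Fin r // δ p.1 p.2 = true} → ℝ,
      ((fillIn δ x).submatrix f id).det ≠ 0 := by
  classical
  -- Moving along `v` adds t to the diagonal of the minor only, since `f` is injective. On each such
  -- line the determinant is a monic characteristic polynomial with finitely many roots; null sets
  -- on all parallel lines give a null set.
  let v : {p : Fin m × Fin r // δ p.1 p.2 = true} → ℝ := fun p => if p.1.1 = f p.1.2 then 1 else 0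
  let L : ℝ →ₗ[ℝ] ({p : Fin m × Fin r // δ p.1 p.2 = true} → ℝ) := LinearMap.toSpanSingleton ℝ _ v
  have hopen : IsOpen {x | ((fillIn δ x).submatrix f id).det ≠ 0} :=
    isOpen_ne_fun (((continuous_fillIn δ).matrix_submatrix f id).matrix_det) continuous_const
  refine ae_mem_of_ae_add_linearMap_mem L volume volume hopen.measurableSet fun y => ?_
  set A := (fillIn δ y).submatrix f id
  have hline : ∀ t : ℝ, (fillIn δ (y + L t)).submatrix f id = scalar (Fin r) t + A := by
    intro t
    ext a b
    by_cases hab : δ (f a) b = true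
    · by_cases e : a = b
      · subst e
        simp [fillIn, A, L, v, hδ, add_comm]
      · have : f a ≠ f b := fun h => e (hf h)
        simp [fillIn, A, L, v, hab, this, e]
    · have e : a ≠ b := fun e => hab (e ▸ hδ a)
      simp [fillIn, A, hab, e]
  have hfin : {t : ℝ | ((-A).charpoly).IsRoot t}.Finite :=
    Polynomial.finite_setOfPred_isRoot (charpoly_monic _).ne_zero
  refine Filter.mem_of_superset (compl_mem_ae_iff.mpr (hfin.measure_zero volume)) fun t ht => ?_
  change ((fillIn δ (y + L t)).submatrix f id).det ≠ 0
  rw [hline]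
  simpa [Polynomial.IsRoot, Matrix.eval_charpoly] using ht

theorem rank_submatrix_eq_of_det_ne_zero {m r : ℕ} {A : Matrix (Fin m) (Fin r) ℝ}
    {f : Fin r → Fin m} (h : (A.submatrix f id).det ≠ 0) {S : Finset (Fin m)}
    (hf : ∀ j, f j ∈ S) : (A.submatrix (fun k : S => (k : Fin m)) id).rank = r := by
  apply rank_eq_of_forall_mulVec_eq_zero
  intro v hv
  apply Matrix.eq_zero_of_mulVec_eq_zero h
  ext j
  exact congrFun hv ⟨f j, hf j⟩

/-- Under the 3579 counting rule, the row deletion property holds generically. -/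
theorem CountingRule.ae_rowDeletionProperty {m r : ℕ} {δ : Matrix (Fin m) (Fin r) Bool}
    (h : CountingRule δ 1) (ρ : Equiv.Perm (Fin r)) :
    ∀ᵐ x : {p : Fin m × Fin r // δ p.1 p.2 = true} → ℝ,
      RowDeletionProperty ((fillIn δ x).submatrix id ρ) := by
  classical
  choose f hf hfδ using fun i => h.exists_matchings i
  have key : ∀ i b, ∀ᵐ x : {p : Fin m × Fin r // δ p.1 p.2 = true} → ℝ,
      ((fillIn δ x).submatrix (fun j => f i (j, b)) id).det ≠ 0 := fun i b =>
    ae_det_fillIn_submatrix_ne_zero (fun j k hjk => congrArg Prod.fst (hf i hjk))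
      fun j => (hfδ i (j, b)).2
  filter_upwards [ae_all_iff.mpr fun i => ae_all_iff.mpr (key i)] with x hx i
  have hrank : ∀ b, (((fillIn δ x).submatrix id ρ).submatrix
      (fun k : (Finset.univ.image fun j => f i (j, b)) => (k : Fin m)) id).rank = r := by
    intro b
    refine rank_submatrix_eq_of_det_ne_zero (f := fun j => f i (j, b)) ?_ (by simp)
    rw [submatrix_submatrix]
    have := Matrix.det_permute' ρ ((fillIn δ x).submatrix (fun j => f i (j, b)) id)
    rw [submatrix_submatrix] at this
    change ((fillIn δ x).submatrix (fun j => f i (j, b)) ρ).det = _ at this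
    change ((fillIn δ x).submatrix (fun j => f i (j, b)) ρ).det ≠ 0
    rw [this]
    exact mul_ne_zero (by rcases Int.units_eq_one_or (Equiv.Perm.sign ρ) with e | e <;> simp [e])
      (hx i b)
  refine ⟨_, _, ?_, ?_, ?_, hrank true, hrank false⟩
  · simp [fun j b => (hfδ i (j, b)).1]
  · simp [fun j b => (hfδ i (j, b)).1]
  · rw [Finset.disjoint_left]
    intro k hk hk'
    simp only [Finset.mem_image, Finset.mem_univ, true_and] at hk hk'
    obtain ⟨a, rfl⟩ := hk
    obtain ⟨b, hb⟩ := hk'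
    simpa using hf i hb

/-! ### Generic members of `Theta` -/

/-- With all marked entries nonzero, the matrix filled into the sparsity pattern of an unordered
GLT structure belongs to `Theta`. -/
theorem fillIn_mem_Theta {m r : ℕ} {δ : Matrix (Fin m) (Fin r) Bool}
    (hδ : IsUnorderedGLTSparsity δ) {x : {p : Fin m × Fin r // δ p.1 p.2 = true} → ℝ}
    (hx : ∀ p, x p ≠ 0) : fillIn δ x ∈ Theta δ := by
  obtain ⟨β, ⟨-, l, hl, hp⟩, rfl⟩ := hδ
  have hiff : ∀ i j, fillIn (sparsityMatrix β) x i j ≠ 0 ↔ β i j ≠ 0 := by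
    intro i j
    by_cases h : sparsityMatrix β i j = true
    · have h' : β i j ≠ 0 := by simpa [sparsityMatrix] using h
      simp [fillIn, h, h', hx]
    · have h' : ¬ β i j ≠ 0 := by simpa [sparsityMatrix] using h
      simp only [fillIn, h, h']
      simp
  have hpiv : ∀ j, IsPivotRow (fillIn (sparsityMatrix β) x) j (l j) := fun j =>
    ⟨fun i hi => by by_contra h; exact (hiff i j).mp h ((hp j).1 i hi), (hiff _ _).mpr (hp j).2⟩
  refine ⟨fillIn (sparsityMatrix β) x, ⟨rank_eq_of_pivotRows hl hpiv, l, hl, hpiv⟩, ?_,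
    fun _ => 1, 1, fun _ => Or.inl rfl, ?_⟩
  · ext i j
    have := hiff i j
    simp only [sparsityMatrix] at this ⊢
    exact decide_eq_decide.mpr this
  · ext i j
    rw [isSignedPermutation_apply, mul_one]
    rfl

/-- Keeps "almost all β" from being vacuous. The piece of the identity permutation suffices: almost
every parameter vector avoids both N and the coordinate hyperplanes. -/
theorem exists_mem_Theta_notMem_of_isNullInTheta {m r : ℕ} {δ : Matrix (Fin m) (Fin r) Bool}
    (hδ : IsUnorderedGLTSparsity δ) {N : Set (Matrix (Fin m) (Fin r) ℝ)}
    (hN : IsNullInTheta δ N) : ∃ β ∈ Theta δ, β ∉ N := by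
  have h1 : ∀ᵐ x : {p : Fin m × Fin r // δ p.1 p.2 = true} → ℝ, fillIn δ x ∉ N := by
    have := hN 1
    rw [ae_iff]
    simpa using this
  have h2 : ∀ᵐ x : {p : Fin m × Fin r // δ p.1 p.2 = true} → ℝ, ∀ p, x p ≠ 0 :=
    ae_all_iff.mpr fun p => by
      rw [volume_pi]
      exact Measure.ae_eval_ne (μ := fun _ => volume) p 0
  obtain ⟨x, hx1, hx2⟩ := (h1.and h2).exists
  exact ⟨_, fillIn_mem_Theta hδ hx2, hx1⟩

/-! ### GLT representatives by Gram–Schmidt -/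

open InnerProductSpace in
/-- Every matrix of full column rank is, up to an orthogonal transformation of its columns, an
unordered GLT structure. -/
theorem exists_isUnorderedGLT_mul_transpose_eq {m r : ℕ} {A : Matrix (Fin m) (Fin r) ℝ}
    (hA : A.rank = r) : ∃ B : Matrix (Fin m) (Fin r) ℝ, IsUnorderedGLT B ∧ B * Bᵀ = A * Aᵀ := by
  classical
  let a : Fin m → EuclideanSpace ℝ (Fin r) := fun i => WithLp.toLp 2 (A i)
  have hinner : ∀ i v, inner ℝ (a i) v = (A *ᵥ v.ofLp) i := by
    intro i v
    simp [a, PiLp.inner_apply, mulVec, dotProduct, mul_comm]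
  have hspan : Submodule.span ℝ (Set.range a) = ⊤ := by
    rw [← Submodule.orthogonal_eq_bot_iff, Submodule.eq_bot_iff]
    intro v hv
    have : v.ofLp = 0 := by
      apply eq_zero_of_mulVec_eq_zero hA
      ext i
      rw [← hinner]
      exact (Submodule.mem_orthogonal _ v).mp hv _ (Submodule.subset_span ⟨i, rfl⟩)
    exact (WithLp.ofLp_eq_zero 2).mp this
  -- Gram–Schmidt runs over the rows from the top. The nonzero outputs form an orthonormal basis;
  -- the vector produced at row n is orthogonal to all earlier rows but not to row n, so its
  -- coordinate column has pivot row n.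
  let u := gramSchmidtNormed ℝ a
  have horth : Orthonormal ℝ fun i : {i | u i ≠ 0} => u i := gramSchmidtNormed_orthonormal' a
  have hrange : Submodule.span ℝ (Set.range fun i : {i | u i ≠ 0} => u i) = ⊤ := by
    rw [← hspan, ← span_gramSchmidt ℝ a, ← span_gramSchmidtNormed_range]
    refine le_antisymm (Submodule.span_mono ?_) (Submodule.span_le.mpr ?_)
    · rintro _ ⟨i, rfl⟩
      exact ⟨i, rfl⟩
    · rintro _ ⟨i, rfl⟩
      by_cases h : u i = 0
      · change u i ∈ _
        rw [h]; exact Submodule.zero_mem _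
      · exact Submodule.subset_span ⟨⟨i, h⟩, rfl⟩
  let b₀ := OrthonormalBasis.mk horth hrange.ge
  have hcard : Fintype.card {i | u i ≠ 0} = Fintype.card (Fin r) := by
    rw [← Module.finrank_eq_card_basis b₀.toBasis, finrank_euclideanSpace]
  let e := Fintype.equivOfCardEq hcard
  let b := b₀.reindex e
  have hb : ∀ j, b j = u (e.symm j) := fun j => by simp [b, b₀]
  have hpiv : ∀ j, IsPivotRow (fun i j => inner ℝ (b j) (a i) : Matrix (Fin m) (Fin r) ℝ) j
      (e.symm j : {i | u i ≠ 0}).1 := by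
    intro j
    set n : Fin m := (e.symm j).1
    have hu : u n ≠ 0 := (e.symm j).2
    have hg : gramSchmidt ℝ a n ≠ 0 := fun h => hu (by simp [u, gramSchmidtNormed, h])
    refine ⟨fun i hi => ?_, ?_⟩
    · simp only [hb]
      change inner ℝ (u n) (a i) = 0
      simp [u, gramSchmidtNormed, inner_smul_left, gramSchmidt_inv_triangular ℝ a hi]
    · simp only [hb]
      change inner ℝ (u n) (a n) ≠ 0
      have h1 : inner ℝ (gramSchmidt ℝ a n) (a n) =
          inner ℝ (gramSchmidt ℝ a n) (gramSchmidt ℝ a n) := by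
        conv_lhs => rw [gramSchmidt_def'' ℝ a n]
        rw [inner_add_right, inner_sum, Finset.sum_eq_zero, add_zero]
        intro i hi
        rw [inner_smul_right, gramSchmidt_orthogonal ℝ a (Finset.mem_Iio.mp hi).ne', mul_zero]
      simp only [u, gramSchmidtNormed, inner_smul_left, h1]
      simp [hg]
  have hinj : Function.Injective fun j => (e.symm j).1 :=
    Subtype.val_injective.comp e.symm.injective
  refine ⟨_, ⟨rank_eq_of_pivotRows hinj hpiv, _, hinj, hpiv⟩, ?_⟩
  ext i k
  calc ∑ j, inner ℝ (b j) (a i) * inner ℝ (b j) (a k)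
      = ∑ j, inner ℝ (a i) (b j) * inner ℝ (b j) (a k) := by
        simp only [real_inner_comm]
    _ = inner ℝ (a i) (a k) := b.sum_inner_mul_inner _ _
    _ = ∑ j, A i j * A k j := by simp [hinner, a, mulVec, dotProduct]
    _ = (A * Aᵀ) i k := rfl

/-! ### Deformations that destroy variance identification -/

section Paths

open Filter Topology

/-- A path of Gram matrices through `β βᵀ` with constant off-diagonal entries destroys variance
identification. -/
theorem not_varianceIdentified_of_path {m r : ℕ} {β : Matrix (Fin m) (Fin r) ℝ}
    (hβ : β.rank = r) {σ : Fin m → ℝ} (hσ : ∀ i, 0 < σ i) (G : ℝ → Matrix (Fin m) (Fin m) ℝ)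
    (hG : Tendsto G (𝓝[≠] 0) (𝓝 (β * βᵀ)))
    (h : ∀ᶠ t in 𝓝[≠] 0, G t ≠ β * βᵀ ∧ (∀ i k, i ≠ k → G t i k = (β * βᵀ) i k) ∧
      ∃ A : Matrix (Fin m) (Fin r) ℝ, A * Aᵀ = G t) : ¬ VarianceIdentified β σ := by
  intro hvar
  obtain ⟨L, hL⟩ := (rank_eq_iff_exists_left_inverse _).mp hβ
  -- This determinant is 1 at the limit `β βᵀ`. Staying nonzero nearby, it forces every factor `A`
  -- of `G t` to have full column rank.
  have hdet : ∀ᶠ t in 𝓝[≠] 0, (L * G t * Lᵀ).det ≠ 0 := by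
    have hc : Continuous fun M : Matrix (Fin m) (Fin m) ℝ => (L * M * Lᵀ).det := by fun_prop
    have h1 : (L * (β * βᵀ) * Lᵀ).det ≠ 0 := by
      have : L * (β * βᵀ) * Lᵀ = (L * β) * (L * β)ᵀ := by
        rw [transpose_mul]; simp only [Matrix.mul_assoc]
      rw [this, hL]; simp
    exact ((hc.tendsto _).comp hG).eventually_ne h1
  have hpos : ∀ i, ∀ᶠ t in 𝓝[≠] 0, 0 < σ i + (β * βᵀ) i i - G t i i := by
    intro i
    have hc : Continuous fun M : Matrix (Fin m) (Fin m) ℝ => σ i + (β * βᵀ) i i - M i i := by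
      fun_prop
    refine ((hc.tendsto _).comp hG).eventually_const_lt ?_
    simpa using hσ i
  obtain ⟨t, ⟨hne, hoff, A, hA⟩, hd, hp⟩ := (h.and (hdet.and (eventually_all.mpr hpos))).exists
  have hrank : A.rank = r := by
    rw [rank_eq_iff_exists_left_inverse]
    have h1 : (L * A) * (L * A)ᵀ = L * G t * Lᵀ := by
      rw [← hA, transpose_mul]; simp only [Matrix.mul_assoc]
    have h2 : IsUnit (L * A).det := by
      rw [isUnit_iff_ne_zero]
      intro h0
      exact hd (by rw [← h1, det_mul, h0, zero_mul])
    exact ⟨(L * A)⁻¹ * L, by rw [Matrix.mul_assoc, Matrix.nonsing_inv_mul _ h2]⟩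
  obtain ⟨B, hB, hBA⟩ := exists_isUnorderedGLT_mul_transpose_eq hrank
  refine hne ?_
  rw [← hA, ← hBA]
  refine (hvar B (fun i => σ i + (β * βᵀ) i i - G t i i) ⟨hB, hp, ?_⟩).2
  rw [hBA, hA]
  ext i k
  by_cases hik : i = k
  · subst hik; simp; ring
  · simp only [Matrix.add_apply, diagonal_apply_ne _ hik, hoff i k hik]

theorem updateCol_mul_transpose_apply {m r : ℕ} (β : Matrix (Fin m) (Fin r) ℝ) (j : Fin r)
    (a : Fin m → ℝ) (i k : Fin m) :
    (β.updateCol j a * (β.updateCol j a)ᵀ) i k =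
      (β * βᵀ) i k - β i j * β k j + a i * a k := by
  rw [mul_apply, mul_apply, ← Finset.add_sum_erase _ _ (Finset.mem_univ j),
    ← Finset.add_sum_erase (a := j) _ (fun l => β i l * βᵀ l k) (Finset.mem_univ j)]
  have : ∑ l ∈ Finset.univ.erase j, β.updateCol j a i l * (β.updateCol j a)ᵀ l k =
      ∑ l ∈ Finset.univ.erase j, β i l * βᵀ l k :=
    Finset.sum_congr rfl fun l hl => by simp [(Finset.mem_erase.mp hl).1]
  rw [this]
  simp only [updateCol_self, transpose_apply]
  ring

/-- A column with at most one nonzero entry besides row `a` can be rescaled. -/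
theorem not_varianceIdentified_of_column {m r : ℕ} {β : Matrix (Fin m) (Fin r) ℝ}
    (hβ : β.rank = r) {σ : Fin m → ℝ} (hσ : ∀ i, 0 < σ i) {j : Fin r} {a b : Fin m}
    (ha : β a j ≠ 0) (hb : ∀ i, i ≠ a → β i j ≠ 0 → i = b) : ¬ VarianceIdentified β σ := by
  -- Reciprocal scaling preserves every product of entry a with another entry. Two distinct rows
  -- other than a have product zero, so only the diagonal moves.
  let c : ℝ → Fin m → ℝ := fun t i => if i = a then (1 + t) * β i j else β i j / (1 + t)
  have hc0 : ∀ i, Tendsto (fun t => c t i) (𝓝[≠] 0) (𝓝 (β i j)) := by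
    intro i
    have hc : ContinuousAt (fun t => c t i) 0 := by
      by_cases hi : i = a
      · simp only [c, hi, if_true]; fun_prop
      · simp only [c, hi, if_false]
        exact ContinuousAt.div (by fun_prop) (by fun_prop) (by norm_num)
    have h0 : c 0 i = β i j := by simp [c]
    rw [← h0]
    exact hc.tendsto.mono_left nhdsWithin_le_nhds
  refine not_varianceIdentified_of_path hβ hσ
    (fun t => β.updateCol j (c t) * (β.updateCol j (c t))ᵀ) ?_ ?_
  · refine tendsto_pi_nhds.mpr fun i => tendsto_pi_nhds.mpr fun k => ?_
    simp only [updateCol_mul_transpose_apply]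
    simpa using (tendsto_const_nhds (x := (β * βᵀ) i k - β i j * β k j)).add
      ((hc0 i).mul (hc0 k))
  · have hsmall : ∀ᶠ t : ℝ in 𝓝[≠] 0, -1 < t :=
      nhdsWithin_le_nhds (lt_mem_nhds (by norm_num))
    filter_upwards [self_mem_nhdsWithin, hsmall] with t ht htp
    have ht0 : t ≠ 0 := ht
    have h1t : 1 + t ≠ 0 := by linarith
    refine ⟨fun h => ?_, fun i k hik => ?_, _, rfl⟩
    · have := congrFun (congrFun h a) a
      rw [updateCol_mul_transpose_apply] at this
      simp only [c, if_true] at this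
      have h2 : t * (t + 2) * (β a j * β a j) = 0 := by linear_combination this
      have h3 : t + 2 ≠ 0 := by linarith
      exact mul_ne_zero (mul_ne_zero ht0 h3) (mul_ne_zero ha ha) h2
    · rw [updateCol_mul_transpose_apply]
      have : c t i * c t k = β i j * β k j := by
        by_cases hi : i = a
        · have hk : k ≠ a := fun e => hik (hi.trans e.symm)
          simp only [c, hi, hk, if_true, if_false]
          field_simp
        · by_cases hk : k = a
          · simp only [c, hi, hk, if_true, if_false]
            field_simp
          · simp only [c, hi, hk, if_false]
            by_cases hi0 : β i j = 0
            · simp [hi0]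
            · by_cases hk0 : β k j = 0
              · simp [hk0]
              · exact absurd ((hb i hi hi0).trans (hb k hk hk0).symm) hik
      rw [this]; ring

/-- A conic without constant term that is bilinear in its quadratic part contains a curve through
the origin. -/
theorem exists_path_bilinear (E F c : ℝ) : ∃ h k : ℝ → ℝ,
    ContinuousAt h 0 ∧ ContinuousAt k 0 ∧ h 0 = 0 ∧ k 0 = 0 ∧
    ∀ᶠ t in 𝓝[≠] 0, (h t ≠ 0 ∨ k t ≠ 0) ∧ E * k t + F * h t - c * h t * k t = 0 := by
  by_cases hE : E = 0
  · refine ⟨fun _ => 0, id, continuousAt_const, continuousAt_id, rfl, rfl, ?_⟩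
    filter_upwards [self_mem_nhdsWithin] with t ht
    exact ⟨Or.inr ht, by simp [hE]⟩
  · have hden : ContinuousAt (fun t => E - c * t) 0 := by fun_prop
    refine ⟨id, fun t => -F * t / (E - c * t), continuousAt_id,
      ContinuousAt.div (by fun_prop) hden (by simpa using hE), rfl, by simp, ?_⟩
    have hne : ∀ᶠ t in 𝓝[≠] 0, E - c * t ≠ 0 :=
      (hden.tendsto.mono_left nhdsWithin_le_nhds).eventually_ne (by simpa using hE)
    filter_upwards [self_mem_nhdsWithin, hne] with t ht htE
    refine ⟨Or.inl ht, ?_⟩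
    simp only [id]
    linear_combination div_mul_cancel₀ (-F * t) htE

/-- A quadratic form given by the inverse of a positive definite 2 × 2 matrix is a sum of two
squares. -/
theorem exists_two_column_factor {ι : Type*} {p q s : ℝ} (hp : 0 < p) (hpq : 0 < p * q - s ^ 2)
    (x y : ι → ℝ) : ∃ a b : ι → ℝ, ∀ i k, a i * a k + b i * b k =
      (q * (x i * x k) - s * (x i * y k + y i * x k) + p * (y i * y k)) / (p * q - s ^ 2) := by
  -- Completing the square: the form equals x²/p + (p y − s x)²/(p (p q − s²)).
  refine ⟨fun i => x i / √p, fun i => (p * y i - s * x i) / √(p * (p * q - s ^ 2)), fun i k => ?_⟩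
  have h1 : x i / √p * (x k / √p) = x i * x k / p := by
    rw [div_mul_div_comm, Real.mul_self_sqrt hp.le]
  have h2 : (p * y i - s * x i) / √(p * (p * q - s ^ 2)) *
      ((p * y k - s * x k) / √(p * (p * q - s ^ 2))) =
      (p * y i - s * x i) * (p * y k - s * x k) / (p * (p * q - s ^ 2)) := by
    rw [div_mul_div_comm, Real.mul_self_sqrt (mul_pos hp hpq).le]
  rw [h1, h2]
  have := hpq.ne'
  field_simp
  ring

/-- Two columns that are linearly independent on the rows `x`, `y` and have at most two further
nonzero rows `k₀`, `l₀` can be deformed. -/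
theorem not_varianceIdentified_of_two_columns {m r : ℕ} {β : Matrix (Fin m) (Fin r) ℝ}
    (hβ : β.rank = r) {σ : Fin m → ℝ} (hσ : ∀ i, 0 < σ i) {j₁ j₂ : Fin r} (hj : j₁ ≠ j₂)
    {x y k₀ l₀ : Fin m} (hdet : β x j₁ * β y j₂ - β x j₂ * β y j₁ ≠ 0)
    (hrows : ∀ i, i ≠ x → i ≠ y → β i j₁ ≠ 0 ∨ β i j₂ ≠ 0 → i = k₀ ∨ i = l₀) :
    ¬ VarianceIdentified β σ := by
  have hxy : x ≠ y := by
    rintro rfl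
    exact hdet (by ring)
  let M : Fin m → Fin m → ℝ := fun i k => β i j₁ * β k j₁ + β i j₂ * β k j₂
  have hMdef : ∀ i k, M i k = β i j₁ * β k j₁ + β i j₂ * β k j₂ := fun _ _ => rfl
  have hMsymm : ∀ i k, M i k = M k i := fun i k => by simp only [hMdef]; ring
  -- The two columns contribute a rank-two Gram matrix M, which is recovered from its columns x and
  -- y through the inverse of its 2 × 2 block.
  have hM : ∀ i k, M y y * (M i x * M k x) - M x y * (M i x * M k y + M i y * M k x) +
      M x x * (M i y * M k y) = M i k * (M x x * M y y - M x y ^ 2) := by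
    intro i k
    simp only [hMdef]; ring
  have hG0 : 0 < M x x * M y y - M x y ^ 2 := by
    have : M x x * M y y - M x y ^ 2 = (β x j₁ * β y j₂ - β x j₂ * β y j₁) ^ 2 := by
      simp only [hMdef]; ring
    rw [this]; positivity
  have hp0 : 0 < M x x := by
    by_contra hle
    have h1 : 0 ≤ M y y := by simp only [hMdef]; nlinarith [sq_nonneg (β y j₁), sq_nonneg (β y j₂)]
    nlinarith [sq_nonneg (M x y)]
  -- Here h and k are the increments of `M x x` and `M y y`. The conic says that the rank-two
  -- completion `H` built from the modified block keeps its entry at (k₀, l₀).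
  obtain ⟨h, k, hh, hk, hh0, hk0, hcurve⟩ := exists_path_bilinear
    (M k₀ x * M l₀ x - M k₀ l₀ * M x x) (M k₀ y * M l₀ y - M k₀ l₀ * M y y) (M k₀ l₀)
  let p : ℝ → ℝ := fun t => M x x + h t
  let q : ℝ → ℝ := fun t => M y y + k t
  let cx : ℝ → Fin m → ℝ := fun t i => if i = x then p t else M i x
  let cy : ℝ → Fin m → ℝ := fun t i => if i = y then q t else M i y
  let H : ℝ → Fin m → Fin m → ℝ := fun t i k => (q t * (cx t i * cx t k) -
    M x y * (cx t i * cy t k + cy t i * cx t k) + p t * (cy t i * cy t k)) / (p t * q t - M x y ^ 2)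
  have hpc : ContinuousAt p 0 := continuousAt_const.add hh
  have hqc : ContinuousAt q 0 := continuousAt_const.add hk
  have hp00 : p 0 = M x x := by simp [p, hh0]
  have hq00 : q 0 = M y y := by simp [q, hk0]
  have hcx : ∀ i, ContinuousAt (fun t => cx t i) 0 := by
    intro i
    by_cases hi : i = x
    · simpa only [cx, hi, if_true] using hpc
    · simpa only [cx, hi, if_false] using continuousAt_const
  have hcy : ∀ i, ContinuousAt (fun t => cy t i) 0 := by
    intro i
    by_cases hi : i = y
    · simpa only [cy, hi, if_true] using hqc
    · simpa only [cy, hi, if_false] using continuousAt_const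
  have hcx0 : ∀ i, cx 0 i = M i x := by
    intro i
    by_cases hi : i = x
    · simp [cx, hi, hp00]
    · simp [cx, hi]
  have hcy0 : ∀ i, cy 0 i = M i y := by
    intro i
    by_cases hi : i = y
    · simp [cy, hi, hq00]
    · simp [cy, hi]
  have hdenc : ContinuousAt (fun t => p t * q t - M x y ^ 2) 0 :=
    (hpc.mul hqc).sub continuousAt_const
  have hden0 : 0 < p 0 * q 0 - M x y ^ 2 := by rw [hp00, hq00]; exact hG0
  have hHc : ∀ i l, ContinuousAt (fun t => H t i l) 0 := by
    intro i l
    exact (((hqc.mul ((hcx i).mul (hcx l))).sub (continuousAt_const.mul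
      (((hcx i).mul (hcy l)).add ((hcy i).mul (hcx l))))).add
      (hpc.mul ((hcy i).mul (hcy l)))).div hdenc hden0.ne'
  have hH0 : ∀ i l, H 0 i l = M i l := by
    intro i l
    simp only [H]
    rw [div_eq_iff hden0.ne', hcx0, hcx0, hcy0, hcy0, hp00, hq00]
    exact hM i l
  refine not_varianceIdentified_of_path hβ hσ
    (fun t i l => (β * βᵀ) i l - M i l + H t i l) ?_ ?_
  · refine tendsto_pi_nhds.mpr fun i => tendsto_pi_nhds.mpr fun l => ?_
    have := (hHc i l).tendsto.mono_left (nhdsWithin_le_nhds (s := {0}ᶜ))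
    rw [hH0] at this
    simpa using (tendsto_const_nhds (x := (β * βᵀ) i l - M i l)).add this
  · have hev1 : ∀ᶠ t in 𝓝[≠] 0, 0 < p t := nhdsWithin_le_nhds
      (hpc.eventually_const_lt (by rw [hp00]; exact hp0))
    have hev2 : ∀ᶠ t in 𝓝[≠] 0, 0 < p t * q t - M x y ^ 2 := nhdsWithin_le_nhds
      (hdenc.eventually_const_lt hden0)
    filter_upwards [hcurve, hev1, hev2] with t ⟨hne, hcv⟩ hpt hdt
    have hHsymm : ∀ i l, H t i l = H t l i := fun i l => by
      simp only [H]; congr 1; ring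
    have hHx : ∀ l, H t x l = cx t l := by
      intro l
      simp only [H]
      rw [div_eq_iff hdt.ne']
      have h1 : cx t x = p t := by simp [cx]
      have h2 : cy t x = M x y := by simp [cy, hxy]
      rw [h1, h2]; ring
    have hHy : ∀ l, H t y l = cy t l := by
      intro l
      simp only [H]
      rw [div_eq_iff hdt.ne']
      have h1 : cx t y = M x y := by simp [cx, hxy.symm, hMsymm y x]
      have h2 : cy t y = q t := by simp [cy]
      rw [h1, h2]; ring
    refine ⟨fun heq => ?_, fun i l hil => ?_, ?_⟩
    · have hx := congrFun (congrFun heq x) x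
      have hy := congrFun (congrFun heq y) y
      simp only [hHx, hHy, cx, cy, p, q, if_true] at hx hy
      rcases hne with h1 | h1
      · exact h1 (by linarith)
      · exact h1 (by linarith)
    · suffices H t i l = M i l by rw [this]; ring
      by_cases hix : i = x
      · subst hix
        rw [hHx, hMsymm]; simp [cx, hil.symm]
      by_cases hiy : i = y
      · subst hiy
        rw [hHy, hMsymm]; simp [cy, hil.symm]
      by_cases hlx : l = x
      · subst hlx
        rw [hHsymm, hHx]; simp [cx, hil]
      by_cases hly : l = y
      · subst hly
        rw [hHsymm, hHy]; simp [cy, hil]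
      simp only [H]
      rw [div_eq_iff hdt.ne']
      simp only [cx, cy, hix, hiy, hlx, hly, if_false]
      -- Outside rows x and y, only the pair k₀, l₀ can have both rows nonzero; the conic settles
      -- it, and all other off-diagonal entries vanish.
      by_cases hi0 : β i j₁ ≠ 0 ∨ β i j₂ ≠ 0
      · by_cases hl0 : β l j₁ ≠ 0 ∨ β l j₂ ≠ 0
        · have hbase := hM k₀ l₀
          have hsym := hMsymm k₀ l₀
          rcases hrows i hix hiy hi0 with rfl | rfl <;> rcases hrows l hlx hly hl0 with rfl | rfl
          · exact absurd rfl hil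
          · simp only [p, q]
            linear_combination hcv + hbase
          · rw [← hsym]
            simp only [p, q]
            linear_combination hcv + hbase
          · exact absurd rfl hil
        · push Not at hl0
          simp [hMdef, hl0.1, hl0.2]
      · push Not at hi0
        simp [hMdef, hi0.1, hi0.2]
    · obtain ⟨a, b, hab⟩ := exists_two_column_factor hpt hdt (cx t) (cy t)
      refine ⟨(β.updateCol j₁ a).updateCol j₂ b, ?_⟩
      ext i l
      rw [updateCol_mul_transpose_apply, updateCol_mul_transpose_apply,
        updateCol_ne hj.symm, updateCol_ne hj.symm]
      linear_combination hab i l + hMdef i l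

end Paths

/-! ### Necessity for at most three factors, and the main theorem -/

theorem not_varianceIdentified_of_nonzeroRows_singleton {m r : ℕ}
    {β : Matrix (Fin m) (Fin r) ℝ} (hβ : IsUnorderedGLT β) {σ : Fin m → ℝ} (hσ : ∀ i, 0 < σ i)
    {j : Fin r} (h : nonzeroRows (sparsityMatrix β) {j} ≤ 2) : ¬ VarianceIdentified β σ := by
  classical
  obtain ⟨a, ha⟩ := hβ.exists_ne_zero j
  have : Nonempty (Fin m) := ⟨a⟩
  rw [nonzeroRows_sparsityMatrix] at h
  simp only [Finset.mem_singleton, exists_eq_left] at h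
  obtain ⟨b, hb⟩ := Finset.card_le_one_iff_subset_singleton.mp
    (show ((Finset.univ.filter fun i => β i j ≠ 0).erase a).card ≤ 1 by
      rw [Finset.card_erase_of_mem (by simpa using ha)]; omega)
  exact not_varianceIdentified_of_column hβ.1 hσ ha fun i hia hi =>
    Finset.mem_singleton.mp (hb (by simp [hia, hi]))

theorem not_varianceIdentified_of_nonzeroRows_pair {m r : ℕ}
    {β : Matrix (Fin m) (Fin r) ℝ} (hβ : IsUnorderedGLT β) {σ : Fin m → ℝ} (hσ : ∀ i, 0 < σ i)
    {j₁ j₂ : Fin r} (hj : j₁ ≠ j₂) (h : nonzeroRows (sparsityMatrix β) {j₁, j₂} ≤ 4) :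
    ¬ VarianceIdentified β σ := by
  classical
  obtain ⟨hrank, l, hl, hp⟩ := hβ
  have hxy : l j₁ ≠ l j₂ := fun e => hj (hl e)
  have : Nonempty (Fin m) := ⟨l j₁⟩
  have hdet : β (l j₁) j₁ * β (l j₂) j₂ - β (l j₁) j₂ * β (l j₂) j₁ ≠ 0 := by
    -- The higher of the two pivot rows lies above the pivot of the other column, so one cross entry
    -- is zero and the minor is the product of the pivots.
    have h0 : β (l j₁) j₂ * β (l j₂) j₁ = 0 := by
      rcases hxy.lt_or_gt with hlt | hlt
      · rw [(hp j₂).1 _ hlt, zero_mul]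
      · rw [(hp j₁).1 _ hlt, mul_zero]
    rw [h0, sub_zero]
    exact mul_ne_zero (hp j₁).2 (hp j₂).2
  rw [nonzeroRows_sparsityMatrix] at h
  simp only [Finset.mem_insert, Finset.mem_singleton, exists_eq_or_imp, exists_eq_left] at h
  set R := Finset.univ.filter fun i => β i j₁ ≠ 0 ∨ β i j₂ ≠ 0 with hR
  have hR' : ((R.erase (l j₁)).erase (l j₂)).card ≤ 2 := by
    rw [Finset.card_erase_of_mem, Finset.card_erase_of_mem]
    · omega
    · simp [hR, (hp j₁).2]
    · simp [hR, (hp j₂).2, hxy.symm]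
  have hcover : ∃ k₀ l₀, ∀ i ∈ (R.erase (l j₁)).erase (l j₂), i = k₀ ∨ i = l₀ := by
    rcases ((R.erase (l j₁)).erase (l j₂)).eq_empty_or_nonempty with he | ⟨k₀, hk₀⟩
    · rw [he]
      exact ⟨l j₁, l j₁, by simp⟩
    · obtain ⟨l₀, hl₀⟩ := Finset.card_le_one_iff_subset_singleton.mp
        (show (((R.erase (l j₁)).erase (l j₂)).erase k₀).card ≤ 1 by
          rw [Finset.card_erase_of_mem hk₀]; omega)
      refine ⟨k₀, l₀, fun i hi => or_iff_not_imp_left.mpr fun hik => ?_⟩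
      exact Finset.mem_singleton.mp (hl₀ (Finset.mem_erase.mpr ⟨hik, hi⟩))
  obtain ⟨k₀, l₀, hkl⟩ := hcover
  exact not_varianceIdentified_of_two_columns hrank hσ hj hdet fun i hi₁ hi₂ hi =>
    hkl i (by simp [hR, hi₁, hi₂, hi])

/-- For at most three factors (with at least seven nonzero rows for three), variance identification
implies the 3579 counting rule. -/
theorem countingRule_of_varianceIdentified {m r : ℕ} {δ : Matrix (Fin m) (Fin r) Bool}
    (hr : r = 1 ∨ r = 2 ∨ (r = 3 ∧ 7 ≤ nonzeroRows δ Finset.univ))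
    {β : Matrix (Fin m) (Fin r) ℝ} (hβ : β ∈ Theta δ) {σ : Fin m → ℝ} (hσ : ∀ i, 0 < σ i)
    (hvar : VarianceIdentified β σ) : CountingRule δ 1 := by
  obtain ⟨hGLT, -⟩ := exists_perm_nonzeroRows_sparsityMatrix hβ
  apply countingRule_sparsityMatrix hβ
  intro J hJ
  by_contra hlt
  have hJpos := hJ.card_pos
  have hJle : J.card ≤ r := by simpa using Finset.card_le_univ J
  have hcard : J.card = 1 ∨ J.card = 2 := by
    by_contra hne
    have h3 : J.card = r := by omega
    have hJu : J = Finset.univ := (Finset.card_eq_iff_eq_univ J).mp (by simpa using h3)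
    rw [hJu, nonzeroRows_sparsityMatrix_univ hβ, ← hJu] at hlt
    rw [← hJu] at hr
    omega
  rcases hcard with h1 | h2
  · obtain ⟨j, rfl⟩ := Finset.card_eq_one.mp h1
    exact not_varianceIdentified_of_nonzeroRows_singleton (j := j) hGLT hσ (by omega) hvar
  · obtain ⟨j₁, j₂, hj, rfl⟩ := Finset.card_eq_two.mp h2
    exact not_varianceIdentified_of_nonzeroRows_pair hGLT hσ hj (by omega) hvar

theorem CountingRule.isNullInTheta_not_rowDeletionProperty {m r : ℕ}
    {δ : Matrix (Fin m) (Fin r) Bool} (h : CountingRule δ 1) :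
    IsNullInTheta δ {β | ¬ RowDeletionProperty β} := fun ρ =>
  ae_iff.mp (h.ae_rowDeletionProperty ρ)

theorem corollary1 {m r : ℕ} (δ : Matrix (Fin m) (Fin r) Bool)
    (hδ : IsUnorderedGLTSparsity δ) :
    -- (a)
    (CountingRule δ 1 →
      ∃ N : Set (Matrix (Fin m) (Fin r) ℝ), IsNullInTheta δ N ∧
        ∀ β ∈ Theta δ, β ∉ N → ∀ σ : Fin m → ℝ, (∀ i, 0 < σ i) →
          VarianceIdentified β σ ∧
          ∀ (B : Matrix (Fin m) (Fin r) ℝ) (τ : Fin m → ℝ),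
            IsGLTDecomposition (β * βᵀ + Matrix.diagonal σ) B τ →
              τ = σ ∧ B * Bᵀ = β * βᵀ ∧ IsSignedPermutation B β) ∧
    -- (b)
    (¬ CountingRule δ 1 → ∀ β ∈ Theta δ, ¬ RowDeletionProperty β) ∧
    -- (c)
    (r = 1 ∨ r = 2 ∨ (r = 3 ∧ 7 ≤ nonzeroRows δ Finset.univ) →
      (CountingRule δ 1 ↔
        ∃ N : Set (Matrix (Fin m) (Fin r) ℝ), IsNullInTheta δ N ∧
          ∀ β ∈ Theta δ, β ∉ N → ∀ σ : Fin m → ℝ, (∀ i, 0 < σ i) → VarianceIdentified β σ) ∧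
      (∀ β ∈ Theta δ, ∀ σ : Fin m → ℝ, (∀ i, 0 < σ i) → VarianceIdentified β σ →
        CountingRule δ 1)) := by
  refine ⟨fun hCR => ⟨_, hCR.isNullInTheta_not_rowDeletionProperty, fun β hβ hN σ _ => ?_⟩,
    fun hCR β hβ hAR => ?_, fun hr => ⟨⟨fun hCR => ?_, ?_⟩, fun β hβ σ hσ hvar => ?_⟩⟩
  · have hvar := (not_not.mp hN : RowDeletionProperty β).varianceIdentified σ
    refine ⟨hvar, fun B τ hB => ⟨(hvar B τ hB).1, (hvar B τ hB).2, ?_⟩⟩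
    exact isSignedPermutation_of_mul_transpose_eq
      (exists_perm_nonzeroRows_sparsityMatrix hβ).1 hB.1 (hvar B τ hB).2
  · exact hCR (countingRule_sparsityMatrix hβ (hAR.countingRule
      (exists_perm_nonzeroRows_sparsityMatrix hβ).1.exists_ne_zero))
  · exact ⟨_, hCR.isNullInTheta_not_rowDeletionProperty, fun β _ hN σ _ =>
      (not_not.mp hN : RowDeletionProperty β).varianceIdentified σ⟩
  · rintro ⟨N, hN, hvar⟩
    obtain ⟨β, hβ, hβN⟩ := exists_mem_Theta_notMem_of_isNullInTheta hδ hN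
    -- Identification at a single point already forces the counting rule, so any positive variances
    -- serve.
    exact countingRule_of_varianceIdentified hr hβ (σ := fun _ => 1) (fun _ => one_pos)
      (hvar β hβ hβN _ fun _ => one_pos)
  · exact countingRule_of_varianceIdentified hr hβ hσ hvar
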